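/- Let $p$ be a prime, $a,r\ge 1$ integers, $q=p^a$, and let $\sigma:\mathbb{F}_{q^r}\to\mathbb{F}_{q^r}$ be the map $\sigma(x)=x^q$. Let $\mathbb{F}_{q^r}[X,\sigma]$ be the ring of skew polynomials over $\mathbb{F}_{q^r}$, with multiplication determined by $X\cdot c=\sigma(c)\cdot X$ for $c\in\mathbb{F}_{q^r}$. Say that $D$ is a right divisor of $P$ (and $P$ a left multiple of $D$) if $P=UD$ for some $U$. Two skew polynomials $P$ and $Q$ are called similar if there is a skew polynomial $U$ such that $1$ is a right greatest common divisor of $U$ and $P$, and $QU$ is a left lowest common multiple of $U$ and $P$. (This is an equivalence relation, and by a theorem of Ore the irreducible factors in any two factorizations of $P$ into irreducibles agree up to order and similarity.) Then the similarity classes of the irreducible factors of any $P\in\mathbb{F}_{q^r}[X,\sigma]$ appear in all possible orders in the factorizations of $P$. That is: if $P=P_1P_2\cdots P_s$ with all $P_i\in\mathbb{F}_{q^r}[X,\sigma]$ irreducible, then for every permutation $\tau$ of $\{1,\dots,s\}$ there are irreducible $Q_1,\dots,Q_s\in\mathbb{F}_{q^r}[X,\sigma]$ such that $P=Q_1Q_2\cdots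 Q_s$ and $Q_i$ is similar to $P_{\tau(i)}$ for all $1\le i\le s$. -/

import Mathlib

noncomputable section

/-- The action of `(ℕ, +)` on `K` in which `1` acts by `σ : x ↦ x ^ (p ^ a)`, the `a`-th power of
the absolute Frobenius, and hence `n` acts by `σ ^ n`. -/
@[reducible] def frobeniusPowerAction (K : Type*) [Field K] (p a : ℕ) [ExpChar K p] :
    MulSemiringAction (Multiplicative ℕ) K :=
  MulSemiringAction.compHom K (powersHom (K →+* K) (iterateFrobenius K p a))

/-- The ring `K[X, σ]` of skew polynomials over `K`, where `σ x = x ^ (p ^ a)`: left `K`-linear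
combinations of powers of `X`, multiplied by the rule `X * c = σ c * X`. -/
def FrobeniusSkewPolynomial (K : Type*) [Field K] (p a : ℕ) [ExpChar K p] : Type _ :=
  SkewPolynomial K

namespace FrobeniusSkewPolynomial

instance (K : Type*) [Field K] (p a : ℕ) [ExpChar K p] :
    Ring (FrobeniusSkewPolynomial K p a) :=
  letI := frobeniusPowerAction K p a
  inferInstanceAs (Ring (SkewPolynomial K))

/-- The skew polynomial `c * X ^ n`. -/
def monomial {K : Type*} [Field K] {p a : ℕ} [ExpChar K p] (n : ℕ) (c : K) :
    FrobeniusSkewPolynomial K p a :=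
  (SkewPolynomial.monomial n c : SkewPolynomial K)

/-- The multiplication rule: `(c X ^ n) (d X ^ m) = c σ ^ n (d) X ^ (n + m)`. -/
theorem monomial_mul_monomial {K : Type*} [Field K] {p a : ℕ} [ExpChar K p]
    (n m : ℕ) (c d : K) :
    (monomial n c * monomial m d : FrobeniusSkewPolynomial K p a) =
      monomial (n + m) (c * d ^ ((p ^ a) ^ n)) := by
  letI := frobeniusPowerAction K p a
  have hφ : ∀ x : K, (SkewPolynomial.φ x : K) = x ^ (p ^ a) := fun x => by
    change (powersHom (K →+* K) (iterateFrobenius K p a) (Multiplicative.ofAdd 1)) x = _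
    simp [powersHom_apply, iterateFrobenius_def]
  have hit : ∀ x : K, (SkewPolynomial.φ (R := K))^[n] x = x ^ ((p ^ a) ^ n) := fun x => by
    induction n with
    | zero => simp
    | succ k ih => rw [Function.iterate_succ_apply', ih, hφ, ← pow_mul, ← pow_succ]
  have h := SkewPolynomial.monomial_mul_monomial n m c d
  rw [hit] at h
  exact h

end FrobeniusSkewPolynomial

namespace SkewFactorization

/-- `D` divides `P` on the right. -/
def RightDvd {R : Type*} [Ring R] (D P : R) : Prop := ∃ U : R, P = U * D

/-- `D` is a right greatest common divisor of `P` and `Q`. -/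
def IsRgcd {R : Type*} [Ring R] (D P Q : R) : Prop :=
  RightDvd D P ∧ RightDvd D Q ∧ ∀ E : R, RightDvd E P → RightDvd E Q → RightDvd E D

/-- `M` is a left lowest common multiple of `P` and `Q`. -/
def IsLlcm {R : Type*} [Ring R] (M P Q : R) : Prop :=
  RightDvd P M ∧ RightDvd Q M ∧ ∀ N : R, RightDvd P N → RightDvd Q N → RightDvd M N

/-- `P` and `Q` are similar: for some `U`, the right greatest common divisor of `U` and `P` is `1`
and `Q * U` is the left lowest common multiple of `U` and `P` (both determined up to a unit on the
left). -/
def Similar {R : Type*} [Ring R] (P Q : R) : Prop :=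
  ∃ U : R, IsRgcd 1 U P ∧ IsLlcm (Q * U) U P

/-- `f 0, …, f (s - 1)` is a factorization `P = f 0 * ⋯ * f (s - 1)` (in this order) of `P` as a
product of irreducible elements. -/
def IsFactorization {R : Type*} [Ring R] (P : R) {s : ℕ} (f : Fin s → R) : Prop :=
  (∀ i, Irreducible (f i)) ∧ P = (List.ofFn f).prod

end SkewFactorization

end

noncomputable section

open Submodule

namespace SkewFactorization

/-! Write `R` for the skew polynomial ring. Irreducibles `P` correspond to simple modules `R/RP`,
and isomorphic quotients give similar elements, so it suffices to exchange two adjacent factors `P₁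
P₂` up to isomorphism of quotients (`exists_swap`). If the annihilator of `R/RP₁` lies in that of
`R/RP₂`, the two modules are isomorphic because they are finite and simple, and nothing has to move.
Otherwise some central `z` kills `R/RP₁` but not `R/RP₂`. Then `z` kills the submodule `RP₂/RP₁P₂ ≅
R/RP₁` of `R/RP₁P₂` and is injective on the quotient `R/RP₂`, so the extension splits and the
factors can be swapped (`exists_swap_of_central`). The central element is the crux
(`exists_central_of_not_annihilator_le`). If `X` is injective on both modules, take an element of
the difference of annihilators with fewest terms. Minimality makes it rigid: commuting it past
constants and past `X` can only rescale it, and after normalisation the scalars are trivial. -/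

theorem pow_pow_mul_eq_self {F : Type*} [Monoid F] {q r : ℕ} (hr : ∀ c : F, c ^ (q ^ r) = c)
    (k : ℕ) (c : F) : c ^ (q ^ (r * k)) = c := by
  induction k with
  | zero => simp
  | succ k ih => rw [mul_add, mul_one, pow_add, pow_mul, ih, hr]

/-! ### Quotient modules, similarity and finite simple modules -/

section General

variable {R : Type*} [Ring R]

theorem rightDvd_iff_mem_span {D P : R} : RightDvd D P ↔ P ∈ span R {D} := by
  simp only [RightDvd, mem_span_singleton, smul_eq_mul, eq_comm]

/-- `U` lifts the image of `1`, so `e` is right multiplication by `U`. Its injectivity gives the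
lowest common multiple, its surjectivity the trivial common divisor. -/
theorem similar_of_quotient_equiv {P Q : R}
    (e : (R ⧸ span R {Q}) ≃ₗ[R] (R ⧸ span R {P})) : Similar P Q := by
  obtain ⟨U, hU⟩ := (span R {P}).mkQ_surjective (e ((span R {Q}).mkQ 1))
  have key : ∀ a : R, e ((span R {Q}).mkQ a) = (span R {P}).mkQ (a * U) := fun a => by
    rw [← smul_eq_mul a U, map_smul, hU, ← map_smul, ← map_smul, smul_eq_mul, mul_one]
  have key' : ∀ a : R, a * U ∈ span R {P} ↔ a ∈ span R {Q} := fun a => by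
    rw [← (span R {P}).ker_mkQ, LinearMap.mem_ker, ← key, e.map_eq_zero_iff,
      ← LinearMap.mem_ker, ker_mkQ]
  refine ⟨U, ⟨⟨U, by simp⟩, ⟨P, by simp⟩, ?_⟩, ⟨Q, rfl⟩, ?_, ?_⟩
  · rintro E ⟨A, hA⟩ ⟨B, hB⟩
    obtain ⟨w, hw⟩ := e.surjective ((span R {P}).mkQ 1)
    obtain ⟨v, rfl⟩ := (span R {Q}).mkQ_surjective w
    rw [key, ← sub_eq_zero, ← map_sub, ← LinearMap.mem_ker, ker_mkQ, mem_span_singleton] at hw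
    obtain ⟨c, hc⟩ := hw
    refine ⟨v * A - c * B, ?_⟩
    rw [sub_mul, mul_assoc, mul_assoc, ← hA, ← hB]
    rw [smul_eq_mul] at hc
    rw [hc]; abel
  · rw [rightDvd_iff_mem_span, key']
    exact mem_span_singleton_self Q
  · rintro N ⟨A, rfl⟩ hN
    rw [rightDvd_iff_mem_span, key', mem_span_singleton] at hN
    obtain ⟨c, rfl⟩ := hN
    exact ⟨c, by simp [mul_assoc]⟩

/-- A simple module with finitely many elements is determined by its annihilator, even among
simple modules with a larger annihilator. -/
theorem nonempty_equiv_of_annihilator_le {M N : Type*} [AddCommGroup M] [Module R M]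
    [AddCommGroup N] [Module R N] [Finite M] [IsSimpleModule R M] [IsSimpleModule R N]
    (h : Module.annihilator R M ≤ Module.annihilator R N) : Nonempty (M ≃ₗ[R] N) := by
  classical
  by_contra hne
  have := Fintype.ofFinite M
  obtain ⟨v, hv⟩ : ∃ v : N, v ≠ 0 := by
    have := IsSimpleModule.nontrivial R N
    exact exists_ne 0
  -- A density argument. If adding `s` to `S` fails, then on the annihilator `L` of `S` evaluation
  -- at `v` factors through evaluation at `s`. Both are nonzero maps to simple modules, which yields
  -- `M ≃ N`. Finiteness of `M` then allows `S` to be everything.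
  have key : ∀ S : Finset M, ∃ f : R, (∀ m ∈ S, f • m = 0) ∧ f • v ≠ 0 := by
    intro S
    induction S using Finset.induction_on with
    | empty => exact ⟨1, by simp, by simpa using hv⟩
    | insert s S _ ih =>
      by_contra! hcon
      let L : Submodule R R := ⨅ m ∈ S, LinearMap.ker (LinearMap.toSpanSingleton R M m)
      have hL : ∀ f : R, f ∈ L ↔ ∀ m ∈ S, f • m = 0 := fun f => by simp [L]
      let α : L →ₗ[R] M := (LinearMap.toSpanSingleton R M s).comp L.subtype
      let β : L →ₗ[R] N := (LinearMap.toSpanSingleton R N v).comp L.subtype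
      have hle : LinearMap.ker α ≤ LinearMap.ker β := by
        rintro ⟨f, hf⟩ hfs
        have hfs' : f • s = 0 := hfs
        exact hcon f (by simpa [hfs'] using (hL f).1 hf)
      obtain ⟨f, hf, hfv⟩ := ih
      have hβ : β ≠ 0 := fun h0 => hfv (by
        simpa [β] using LinearMap.congr_fun h0 ⟨f, (hL f).2 hf⟩)
      have hα : α ≠ 0 := fun h0 => hβ (by
        rw [← LinearMap.ker_eq_top] at h0 ⊢
        exact top_le_iff.1 (h0 ▸ hle))
      let e := α.quotKerEquivOfSurjective (LinearMap.surjective_of_ne_zero hα)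
      let g : M →ₗ[R] N := ((LinearMap.ker α).liftQ β hle).comp e.symm.toLinearMap
      have hg : g ≠ 0 := fun h0 => hβ (by
        ext x
        have := LinearMap.congr_fun h0 (α x)
        have hx : e.symm (α x) = (LinearMap.ker α).mkQ x := by
          rw [LinearEquiv.symm_apply_eq]; rfl
        simpa [g, hx] using this)
      exact hne ⟨LinearEquiv.ofBijective g (LinearMap.bijective_of_ne_zero hg)⟩
  obtain ⟨f, hf, hfv⟩ := key Finset.univ
  exact hfv (Module.mem_annihilator.1
    (h (Module.mem_annihilator.2 fun m => hf m (Finset.mem_univ m))) v)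

/-! ### Irreducible elements, maximal left ideals and swapping two factors -/

section Domain

variable [IsDomain R]

/-- The map `a ↦ aB` modulo `D` is onto by `hsup`; by `hinf` and cancellation of `B` its kernel is
`RA`. -/
theorem quotient_equiv_of_inf_eq {A B D : R} (hB : B ≠ 0)
    (hsup : span R {B} ⊔ span R {D} = ⊤)
    (hinf : span R {B} ⊓ span R {D} = span R {A * B}) :
    Nonempty ((R ⧸ span R {A}) ≃ₗ[R] (R ⧸ span R {D})) := by
  let g : R →ₗ[R] (R ⧸ span R {D}) :=
    (span R {D}).mkQ.comp (LinearMap.toSpanSingleton R R B)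
  have hg : ∀ a, g a = (span R {D}).mkQ (a * B) := fun a => rfl
  have hker : LinearMap.ker g = span R {A} := by
    ext a
    rw [LinearMap.mem_ker, hg, ← LinearMap.mem_ker, ker_mkQ]
    have : a * B ∈ span R {D} ↔ a * B ∈ span R {B} ⊓ span R {D} := by
      simp [mem_span_singleton]
    rw [this, hinf, mem_span_singleton, mem_span_singleton]
    simp only [smul_eq_mul, ← mul_assoc, mul_left_inj' hB]
  have hsurj : Function.Surjective g := by
    intro y
    obtain ⟨x, rfl⟩ := (span R {D}).mkQ_surjective y
    have hx : x ∈ span R {B} ⊔ span R {D} := hsup ▸ mem_top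
    obtain ⟨b, hb, d, hd, rfl⟩ := mem_sup.1 hx
    obtain ⟨c, rfl⟩ := mem_span_singleton.1 hb
    refine ⟨c, ?_⟩
    have : (span R {D}).mkQ d = 0 := by rwa [← LinearMap.mem_ker, ker_mkQ]
    rw [hg, map_add, this, add_zero, smul_eq_mul]
  exact ⟨(quotEquivOfEq _ _ hker.symm).trans (g.quotKerEquivOfSurjective hsurj)⟩

theorem isUnit_of_span_eq_top {c : R} (h : span R {c} = ⊤) : IsUnit c := by
  obtain ⟨v, hv⟩ := mem_span_singleton.1 (h ▸ mem_top : (1 : R) ∈ span R {c})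
  rw [smul_eq_mul] at hv
  exact IsUnit.of_mul_eq_one_right v hv

theorem irreducible_of_isCoatom_span {P : R} (h0 : P ≠ 0) (h : IsCoatom (span R {P})) :
    Irreducible P := by
  refine ⟨fun hu => h.1 ?_, fun {b c} hbc => ?_⟩
  · obtain ⟨u, rfl⟩ := hu
    exact (eq_top_iff' ).2 fun x => mem_span_singleton.2 ⟨x * ↑u⁻¹, by simp⟩
  · have hle : span R {P} ≤ span R {c} :=
      (span_singleton_le_iff_mem _ _).2 (mem_span_singleton.2 ⟨b, hbc.symm⟩)
    rcases hle.eq_or_lt with heq | hlt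
    · left
      obtain ⟨w, hw⟩ := mem_span_singleton.1 (heq ▸ mem_span_singleton_self c : c ∈ span R {P})
      have hc : c ≠ 0 := fun hc => h0 (by rw [hbc, hc, mul_zero])
      rw [smul_eq_mul, hbc, ← mul_assoc] at hw
      exact IsUnit.of_mul_eq_one_right w (mul_right_cancel₀ hc (by rw [hw, one_mul]))
    · exact Or.inr (isUnit_of_span_eq_top (h.2 _ hlt))

theorem isCoatom_span_of_irreducible (hpid : ∀ I : Submodule R R, ∃ g, I = span R {g})
    {P : R} (h : Irreducible P) : IsCoatom (span R {P}) := by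
  refine ⟨fun ht => h.1 (isUnit_of_span_eq_top ht), fun I hI => ?_⟩
  obtain ⟨D, rfl⟩ := hpid I
  obtain ⟨b, hb⟩ := mem_span_singleton.1 (hI.le (mem_span_singleton_self P))
  rw [smul_eq_mul] at hb
  rcases h.2 hb.symm with hu | hu
  · obtain ⟨u, rfl⟩ := hu
    refine absurd ?_ hI.not_ge
    rw [span_singleton_le_iff_mem, mem_span_singleton]
    exact ⟨↑u⁻¹, by simp [← hb]⟩
  · obtain ⟨u, rfl⟩ := hu
    exact eq_top_iff'.2 fun x => mem_span_singleton.2 ⟨x * ↑u⁻¹, by simp⟩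

/-- `Q₂` generates `Rz + RP₁P₂`, the preimage of `z · (R/RP₁P₂)`, which is a complement of
`RP₂/RP₁P₂`. Applying `quotient_equiv_of_inf_eq` both ways round gives the two isomorphisms. -/
theorem exists_swap_of_central (hpid : ∀ I : Submodule R R, ∃ g, I = span R {g})
    {P₁ P₂ z : R} (h₁ : Irreducible P₁) (h₂ : Irreducible P₂) (hz : ∀ x, z * x = x * z)
    (hz₁ : z ∈ span R {P₁}) (hz₂ : z ∉ span R {P₂}) :
    ∃ Q₁ Q₂ : R, Irreducible Q₁ ∧ Irreducible Q₂ ∧ Q₁ * Q₂ = P₁ * P₂ ∧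
      Nonempty ((R ⧸ span R {P₂}) ≃ₗ[R] (R ⧸ span R {Q₁})) ∧
      Nonempty ((R ⧸ span R {P₁}) ≃ₗ[R] (R ⧸ span R {Q₂})) := by
  have c₁ := isCoatom_span_of_irreducible hpid h₁
  have c₂ := isCoatom_span_of_irreducible hpid h₂
  obtain ⟨Q₂, hQ₂⟩ := hpid (span R {z} ⊔ span R {P₁ * P₂})
  have hPQ : P₁ * P₂ ∈ span R {Q₂} := hQ₂ ▸ mem_sup_right (mem_span_singleton_self _)
  have hzQ : z ∈ span R {Q₂} := hQ₂ ▸ mem_sup_left (mem_span_singleton_self _)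
  obtain ⟨Q₁, hQ₁⟩ := mem_span_singleton.1 hPQ
  rw [smul_eq_mul] at hQ₁
  have hP : P₁ * P₂ ≠ 0 := mul_ne_zero h₁.ne_zero h₂.ne_zero
  have hQ₁0 : Q₁ ≠ 0 := fun h => hP (by rw [← hQ₁, h, zero_mul])
  have hQ₂0 : Q₂ ≠ 0 := fun h => hP (by rw [← hQ₁, h, mul_zero])
  have hsup : span R {P₂} ⊔ span R {Q₂} = ⊤ :=
    c₂.2 _ (lt_of_le_of_ne le_sup_left fun h => hz₂ (h ▸ mem_sup_right hzQ))
  -- Multiplication by `z` is injective on `R/RP₂`: `I` contains `RP₂` since `z` is central, and is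
  -- proper, so maximality forces equality.
  let I : Submodule R R := (span R {P₂}).comap (LinearMap.toSpanSingleton R R z)
  have hI : ∀ a, a ∈ I ↔ a * z ∈ span R {P₂} := fun a => Iff.rfl
  have hI2 : span R {P₂} = I := by
    by_contra hne
    have hle : span R {P₂} ≤ I := by
      rw [span_singleton_le_iff_mem, hI, ← hz]
      exact mem_span_singleton.2 ⟨z, rfl⟩
    have : (1 : R) ∈ I := c₂.2 _ (lt_of_le_of_ne hle hne) ▸ mem_top
    exact hz₂ (by simpa [hI] using this)
  have hinf : span R {P₂} ⊓ span R {Q₂} = span R {P₁ * P₂} := by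
    apply le_antisymm
    · rintro x ⟨hx₂, hxQ⟩
      rw [SetLike.mem_coe, ← hQ₂] at hxQ
      obtain ⟨y, hy, w, hw, rfl⟩ := mem_sup.1 hxQ
      refine add_mem ?_ hw
      obtain ⟨a, rfl⟩ := mem_span_singleton.1 hy
      obtain ⟨b, rfl⟩ := mem_span_singleton.1 hw
      have hb : b • (P₁ * P₂) ∈ span R {P₂} := mem_span_singleton.2 ⟨b * P₁, by simp [mul_assoc]⟩
      have ha : a ∈ span R {P₂} := by
        rw [hI2, hI]
        exact ((span R {P₂}).add_mem_iff_left hb).1 hx₂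
      -- With `a = cP₂` and `z = uP₁`, centrality gives `az = czP₂ = cuP₁P₂`.
      obtain ⟨c, rfl⟩ := mem_span_singleton.1 ha
      obtain ⟨u, hu⟩ := mem_span_singleton.1 hz₁
      refine mem_span_singleton.2 ⟨c * u, ?_⟩
      simp only [smul_eq_mul] at hu ⊢
      rw [mul_assoc c P₂ z, ← hz P₂, ← hu]
      simp only [mul_assoc]
    · rw [span_singleton_le_iff_mem]
      exact ⟨mem_span_singleton.2 ⟨P₁, rfl⟩, hPQ⟩
  obtain ⟨e₁⟩ := quotient_equiv_of_inf_eq h₂.ne_zero hsup hinf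
  obtain ⟨e₂⟩ := quotient_equiv_of_inf_eq (A := Q₁) hQ₂0 (sup_comm (span R {P₂}) _ ▸ hsup)
    (by rw [inf_comm, hinf, hQ₁])
  have s₁ := isSimpleModule_iff_isCoatom.2 c₁
  have s₂ := isSimpleModule_iff_isCoatom.2 c₂
  exact ⟨Q₁, Q₂,
    irreducible_of_isCoatom_span hQ₁0 (isSimpleModule_iff_isCoatom.1 (IsSimpleModule.congr e₂)),
    irreducible_of_isCoatom_span hQ₂0 (isSimpleModule_iff_isCoatom.1 (IsSimpleModule.congr e₁.symm)),
    hQ₁, ⟨e₂.symm⟩, ⟨e₁⟩⟩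

end Domain

/-- If any two adjacent irreducible factors can be exchanged up to isomorphism of the quotient
modules, then all factors of a product can be permuted. -/
theorem exists_factorization_of_perm
    (hswap : ∀ P₁ P₂ : R, Irreducible P₁ → Irreducible P₂ →
      ∃ Q₁ Q₂ : R, Irreducible Q₁ ∧ Irreducible Q₂ ∧ Q₁ * Q₂ = P₁ * P₂ ∧
        Nonempty ((R ⧸ span R {P₂}) ≃ₗ[R] (R ⧸ span R {Q₁})) ∧
        Nonempty ((R ⧸ span R {P₁}) ≃ₗ[R] (R ⧸ span R {Q₂})))
    {l l' : List R} (h : l.Perm l') :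
    ∀ m : List R, (∀ x ∈ m, Irreducible x) →
      List.Forall₂ (fun P Q : R => Nonempty ((R ⧸ span R {P}) ≃ₗ[R] (R ⧸ span R {Q}))) l m →
      ∃ m' : List R, (∀ x ∈ m', Irreducible x) ∧ m'.prod = m.prod ∧
        List.Forall₂ (fun P Q : R => Nonempty ((R ⧸ span R {P}) ≃ₗ[R] (R ⧸ span R {Q}))) l' m' := by
  -- The list `m` stays arbitrary because each swap replaces factors by others with isomorphic
  -- quotients.
  induction h with
  | nil => exact fun m hm h => ⟨m, hm, rfl, h⟩
  | cons x _ ih =>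
    rintro (_ | ⟨y, m⟩) hm h
    · cases h
    · rw [List.forall₂_cons] at h
      obtain ⟨m', h₁, h₂, h₃⟩ := ih m (fun z hz => hm z (List.mem_cons_of_mem _ hz)) h.2
      exact ⟨y :: m', by simpa using ⟨hm y (by simp), h₁⟩, by simp [h₂], .cons h.1 h₃⟩
  | swap x y l =>
    rintro (_ | ⟨b, _ | ⟨c, m⟩⟩) hm h
    · cases h
    · cases h with | cons _ h => cases h
    · rw [List.forall₂_cons, List.forall₂_cons] at h
      obtain ⟨⟨e₁⟩, ⟨e₂⟩, hl⟩ := h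
      obtain ⟨Q₁, Q₂, i₁, i₂, hQ, ⟨f₁⟩, ⟨f₂⟩⟩ := hswap b c (hm b (by simp)) (hm c (by simp))
      refine ⟨Q₁ :: Q₂ :: m, ?_, ?_, .cons ⟨e₂.trans f₁⟩ (.cons ⟨e₁.trans f₂⟩ hl)⟩
      · simp only [List.mem_cons, forall_eq_or_imp] at hm ⊢
        exact ⟨i₁, i₂, hm.2.2⟩
      · simp only [List.prod_cons, ← mul_assoc, hQ]
  | trans _ _ ih₁ ih₂ =>
    intro m hm h
    obtain ⟨m₁, a₁, a₂, a₃⟩ := ih₁ m hm h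
    obtain ⟨m₂, b₁, b₂, b₃⟩ := ih₂ m₁ a₁ a₃
    exact ⟨m₂, b₁, b₂.trans a₂, b₃⟩

theorem exists_isFactorization_of_perm
    (hswap : ∀ P₁ P₂ : R, Irreducible P₁ → Irreducible P₂ →
      ∃ Q₁ Q₂ : R, Irreducible Q₁ ∧ Irreducible Q₂ ∧ Q₁ * Q₂ = P₁ * P₂ ∧
        Nonempty ((R ⧸ span R {P₂}) ≃ₗ[R] (R ⧸ span R {Q₁})) ∧
        Nonempty ((R ⧸ span R {P₁}) ≃ₗ[R] (R ⧸ span R {Q₂})))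
    {P : R} {s : ℕ} {f : Fin s → R} (hf : IsFactorization P f) (τ : Equiv.Perm (Fin s)) :
    ∃ g : Fin s → R, IsFactorization P g ∧ ∀ i, Similar (f (τ i)) (g i) := by
  have hperm : (List.ofFn f).Perm (List.ofFn fun i => f (τ i)) :=
    (Equiv.Perm.ofFn_comp_perm τ f).symm
  obtain ⟨m, hm, hprod, h⟩ := exists_factorization_of_perm hswap hperm (List.ofFn f)
    (by rintro x hx; obtain ⟨i, rfl⟩ := (List.mem_ofFn' _ _).1 hx; exact hf.1 i)
    (List.forall₂_same.2 fun x _ => ⟨LinearEquiv.refl _ _⟩)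
  obtain ⟨hlen, h⟩ := List.forall₂_iff_get.1 h
  have hs : m.length = s := by simpa using hlen.symm
  subst hs
  refine ⟨m.get, ⟨fun i => hm _ (m.get_mem i), ?_⟩, fun i => ?_⟩
  · rw [List.ofFn_get, hprod, hf.2]
  · have h' := h i (by simp) i.2
    rw [List.get_ofFn] at h'
    obtain ⟨e⟩ := h'
    exact similar_of_quotient_equiv e.symm

end General

end SkewFactorization

/-! ### Coefficients, degree and right division -/

namespace FrobeniusSkewPolynomial

variable {K : Type*} [Field K] {p a : ℕ} [ExpChar K p]

/-- The coefficient of `X ^ n`. -/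
def coeff (f : FrobeniusSkewPolynomial K p a) (n : ℕ) : K :=
  SkewPolynomial.coeff (R := K) f n

/-- The exponents that occur in a skew polynomial. -/
def support (f : FrobeniusSkewPolynomial K p a) : Finset ℕ :=
  SkewPolynomial.support (R := K) f

@[simp] theorem mem_support {f : FrobeniusSkewPolynomial K p a} {n : ℕ} :
    n ∈ f.support ↔ f.coeff n ≠ 0 :=
  SkewPolynomial.mem_support_iff (R := K) (p := f)

theorem ext_coeff {f g : FrobeniusSkewPolynomial K p a} (h : ∀ n, f.coeff n = g.coeff n) :
    f = g :=
  SkewMonoidAlgebra.ext (p := (f : SkewPolynomial K)) (q := g) fun n => h n.toAdd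

@[simp] theorem coeff_zero (n : ℕ) : (0 : FrobeniusSkewPolynomial K p a).coeff n = 0 := rfl

@[simp] theorem coeff_add (f g : FrobeniusSkewPolynomial K p a) (n : ℕ) :
    (f + g).coeff n = f.coeff n + g.coeff n :=
  DFunLike.congr_fun (SkewMonoidAlgebra.coeff_add (f : SkewPolynomial K) (g : SkewPolynomial K))
    (Multiplicative.ofAdd n)

/-- `coeff` as an additive homomorphism. -/
def coeffHom (n : ℕ) : FrobeniusSkewPolynomial K p a →+ K where
  toFun f := f.coeff n
  map_zero' := coeff_zero n
  map_add' f g := coeff_add f g n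

@[simp] theorem coeff_sub (f g : FrobeniusSkewPolynomial K p a) (n : ℕ) :
    (f - g).coeff n = f.coeff n - g.coeff n := map_sub (coeffHom n) f g

theorem coeff_monomial (n m : ℕ) (c : K) :
    (monomial n c : FrobeniusSkewPolynomial K p a).coeff m = if n = m then c else 0 :=
  SkewPolynomial.coeff_monomial

theorem monomial_zero_one : (monomial 0 1 : FrobeniusSkewPolynomial K p a) = 1 := rfl

theorem coeff_sum {ι : Type*} (s : Finset ι) (f : ι → FrobeniusSkewPolynomial K p a) (n : ℕ) :
    (∑ i ∈ s, f i).coeff n = ∑ i ∈ s, (f i).coeff n := map_sum (coeffHom n) f s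

theorem induction_monomial_add {motive : FrobeniusSkewPolynomial K p a → Prop}
    (f : FrobeniusSkewPolynomial K p a) (zero : motive 0)
    (monomial : ∀ n c, motive (monomial n c)) (add : ∀ f g, motive f → motive g → motive (f + g)) :
    motive f :=
  SkewPolynomial.induction (R := K) (motive := motive) f zero
    fun n c _ _ _ hq => add _ _ (monomial n c) hq

theorem exists_vanish_above (f : FrobeniusSkewPolynomial K p a) :
    ∃ N, ∀ i, N ≤ i → f.coeff i = 0 :=
  ⟨f.support.sup id + 1, fun i hi => by
    by_contra h
    have := Finset.le_sup (f := id) (mem_support.2 h)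
    simp only [id] at this
    omega⟩

theorem exists_degree {f : FrobeniusSkewPolynomial K p a} (hf : f ≠ 0) :
    ∃ n, f.coeff n ≠ 0 ∧ ∀ i, n < i → f.coeff i = 0 := by
  classical
  have h := exists_vanish_above f
  have hs := Nat.find_spec h
  rcases hN : Nat.find h with _ | n
  · rw [hN] at hs
    exact absurd (ext_coeff fun i => hs i (Nat.zero_le i)) hf
  · rw [hN] at hs
    refine ⟨n, fun h0 => ?_, fun i hi => hs i hi⟩
    refine Nat.find_min h (m := n) (by omega) fun i hi => ?_
    rcases hi.eq_or_lt with rfl | hi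
    exacts [h0, hs i hi]

theorem eq_sum_monomial {f : FrobeniusSkewPolynomial K p a} {N : ℕ}
    (h : ∀ i, N ≤ i → f.coeff i = 0) : f = ∑ i : Fin N, monomial i (f.coeff i) := by
  refine ext_coeff fun n => ?_
  rw [coeff_sum, Fin.sum_univ_eq_sum_range
    (fun i => (monomial i (f.coeff i) : FrobeniusSkewPolynomial K p a).coeff n)]
  simp only [coeff_monomial, Finset.sum_ite_eq', Finset.mem_range]
  split_ifs with hn
  · rfl
  · exact h n (not_lt.1 hn)

theorem pow_pow_add (n : ℕ) (x y : K) :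
    (x + y) ^ ((p ^ a) ^ n) = x ^ ((p ^ a) ^ n) + y ^ ((p ^ a) ^ n) := by
  rw [← pow_mul]
  exact add_pow_expChar_pow x y p (a * n)

theorem pow_pow_ne_zero (K : Type*) [Field K] (p a n : ℕ) [ExpChar K p] : (p ^ a) ^ n ≠ 0 :=
  pow_ne_zero _ (pow_ne_zero _ (expChar_pos K p).ne')

@[simp] theorem zero_pow_pow (n : ℕ) : (0 : K) ^ ((p ^ a) ^ n) = 0 :=
  zero_pow (pow_pow_ne_zero K p a n)

theorem coeff_monomial_mul (n k : ℕ) (c : K) (f : FrobeniusSkewPolynomial K p a) :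
    (monomial n c * f).coeff k =
      if n ≤ k then c * f.coeff (k - n) ^ ((p ^ a) ^ n) else 0 := by
  induction f using induction_monomial_add with
  | zero => simp
  | monomial m d =>
    rw [monomial_mul_monomial, coeff_monomial, coeff_monomial]
    by_cases h : n + m = k
    · subst h; simp
    · rw [if_neg h]
      split_ifs with h₁ h₂
      · omega
      · simp
      · rfl
  | add f g hf hg =>
    rw [mul_add, coeff_add, hf, hg]
    split_ifs
    · rw [coeff_add, pow_pow_add, mul_add]
    · simp

theorem coeff_mul_monomial (m k : ℕ) (d : K) (f : FrobeniusSkewPolynomial K p a) :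
    (f * monomial m d).coeff k =
      if m ≤ k then f.coeff (k - m) * d ^ ((p ^ a) ^ (k - m)) else 0 := by
  induction f using induction_monomial_add with
  | zero => simp
  | monomial n c =>
    rw [monomial_mul_monomial, coeff_monomial, coeff_monomial]
    by_cases h : n + m = k
    · subst h; simp
    · rw [if_neg h]
      split_ifs with h₁ h₂
      · omega
      · simp
      · rfl
  | add f g hf hg =>
    rw [add_mul, coeff_add, hf, hg]
    split_ifs
    · rw [coeff_add, add_mul]
    · simp

theorem coeff_mul (f g : FrobeniusSkewPolynomial K p a) (k : ℕ) :
    (f * g).coeff k =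
      ∑ i ∈ Finset.range (k + 1), f.coeff i * g.coeff (k - i) ^ ((p ^ a) ^ i) := by
  induction f using induction_monomial_add with
  | zero => simp
  | monomial n c =>
    rw [coeff_monomial_mul]
    simp only [coeff_monomial, ite_mul, zero_mul, Finset.sum_ite_eq, Finset.mem_range,
      Nat.lt_succ_iff]
  | add f₁ f₂ h₁ h₂ =>
    rw [add_mul, coeff_add, h₁, h₂, ← Finset.sum_add_distrib]
    simp only [coeff_add, add_mul]

theorem coeff_mul_of_degree {f g : FrobeniusSkewPolynomial K p a} {n m : ℕ}
    (hf : ∀ i, n < i → f.coeff i = 0) (hg : ∀ i, m < i → g.coeff i = 0) :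
    (f * g).coeff (n + m) = f.coeff n * g.coeff m ^ ((p ^ a) ^ n) := by
  rw [coeff_mul, Finset.sum_eq_single n]
  · simp
  · intro i _ hi
    rcases lt_or_gt_of_ne hi with h | h
    · rw [hg _ (by omega), zero_pow_pow, mul_zero]
    · rw [hf _ h, zero_mul]
  · intro h
    simp only [Finset.mem_range] at h
    omega

instance : Nontrivial (FrobeniusSkewPolynomial K p a) :=
  ⟨⟨1, 0, fun h => one_ne_zero (α := K) (by
    have := congrArg (fun f => coeff f 0) h
    simp [← monomial_zero_one, coeff_monomial] at this)⟩⟩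

instance : NoZeroDivisors (FrobeniusSkewPolynomial K p a) where
  eq_zero_or_eq_zero_of_mul_eq_zero {f g} h := by
    by_contra! hne
    obtain ⟨n, hn, hn'⟩ := exists_degree hne.1
    obtain ⟨m, hm, hm'⟩ := exists_degree hne.2
    have := coeff_mul_of_degree hn' hm'
    rw [h, coeff_zero] at this
    exact mul_ne_zero hn (pow_ne_zero _ hm) this.symm

instance : IsDomain (FrobeniusSkewPolynomial K p a) :=
  NoZeroDivisors.to_isDomain _

/-- Right division with remainder. -/
theorem exists_remainder {P : FrobeniusSkewPolynomial K p a} {m : ℕ} (hm : P.coeff m ≠ 0)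
    (hP : ∀ i, m < i → P.coeff i = 0) (f : FrobeniusSkewPolynomial K p a) :
    ∃ u, ∀ i, m ≤ i → (f - u * P).coeff i = 0 := by
  obtain ⟨N, hN⟩ := exists_vanish_above f
  induction N generalizing f with
  | zero => exact ⟨0, fun i _ => by simpa using hN i (Nat.zero_le i)⟩
  | succ N ih =>
    by_cases hmN : m ≤ N
    · let t : FrobeniusSkewPolynomial K p a :=
        monomial (N - m) (f.coeff N / P.coeff m ^ ((p ^ a) ^ (N - m)))
      obtain ⟨u, hu⟩ := ih (f - t * P) (fun i hi => by
        rw [coeff_sub, coeff_monomial_mul, if_pos (by omega)]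
        rcases hi.eq_or_lt with rfl | hi
        · rw [Nat.sub_sub_self hmN, div_mul_cancel₀ _ (pow_ne_zero _ hm), sub_self]
        · rw [hN i hi, hP (i - (N - m)) (by omega), zero_pow_pow, mul_zero, sub_zero])
      exact ⟨t + u, fun i hi => by rw [add_mul, ← sub_sub]; exact hu i hi⟩
    · exact ⟨0, fun i hi => by simpa using hN i (by omega)⟩

theorem exists_eq_span_singleton (I : Submodule (FrobeniusSkewPolynomial K p a)
    (FrobeniusSkewPolynomial K p a)) : ∃ g, I = span (FrobeniusSkewPolynomial K p a) {g} := by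
  classical
  by_cases hI : I = ⊥
  · exact ⟨0, by simp [hI]⟩
  have hex : ∃ n, ∃ g ∈ I, g.coeff n ≠ 0 ∧ ∀ i, n < i → g.coeff i = 0 := by
    obtain ⟨g, hg, h0⟩ := I.ne_bot_iff.1 hI
    obtain ⟨n, hn⟩ := exists_degree h0
    exact ⟨n, g, hg, hn⟩
  obtain ⟨g, hg, hn, hn'⟩ := Nat.find_spec hex
  refine ⟨g, le_antisymm (fun f hf => ?_) ((span_singleton_le_iff_mem _ _).2 hg)⟩
  obtain ⟨u, hu⟩ := exists_remainder hn hn' f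
  by_cases h0 : f - u * g = 0
  · exact mem_span_singleton.2 ⟨u, (sub_eq_zero.1 h0).symm⟩
  · obtain ⟨m, hm, hm'⟩ := exists_degree h0
    refine absurd ⟨_, I.sub_mem hf (I.smul_mem u hg), hm, hm'⟩ (Nat.find_min hex (m := m) ?_)
    by_contra hlt
    exact hm (hu m (not_lt.1 hlt))

/-- Every class contains a remainder of degree below that of `P`. -/
theorem finite_quotient_span_singleton [Finite K] {P : FrobeniusSkewPolynomial K p a}
    (h0 : P ≠ 0) : Finite (FrobeniusSkewPolynomial K p a ⧸
      span (FrobeniusSkewPolynomial K p a) {P}) := by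
  obtain ⟨m, hm, hm'⟩ := exists_degree h0
  refine Finite.of_surjective (fun x : Fin m → K =>
    (span (FrobeniusSkewPolynomial K p a) {P}).mkQ (∑ i : Fin m, monomial i (x i))) fun y => ?_
  obtain ⟨f, rfl⟩ := (span (FrobeniusSkewPolynomial K p a) {P}).mkQ_surjective y
  obtain ⟨u, hu⟩ := exists_remainder hm hm' f
  refine ⟨fun i => (f - u * P).coeff i, ?_⟩
  dsimp only
  rw [← eq_sum_monomial hu, ← sub_eq_zero, ← map_sub, ← LinearMap.mem_ker, ker_mkQ]
  exact mem_span_singleton.2 ⟨-u, by simp⟩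

-- Commutation with constants and with `X`

local notation "𝐑" => FrobeniusSkewPolynomial K p a

theorem monomial_one_pow (n : ℕ) : (monomial 1 1 : 𝐑) ^ n = monomial n 1 := by
  induction n with
  | zero => rfl
  | succ n ih => rw [pow_succ, ih, monomial_mul_monomial, one_pow, mul_one]

theorem monomial_eq_mul_pow (n : ℕ) (c : K) :
    (monomial n c : 𝐑) = monomial 0 c * monomial 1 1 ^ n := by
  rw [monomial_one_pow, monomial_mul_monomial, one_pow, mul_one, zero_add]

theorem monomial_zero_inv_mul {c : K} (hc : c ≠ 0) :
    (monomial 0 c⁻¹ * monomial 0 c : 𝐑) = 1 := by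
  rw [monomial_mul_monomial, pow_zero, pow_one, inv_mul_cancel₀ hc, monomial_zero_one]

theorem exists_X_mul_eq (f : 𝐑) : ∃ g : 𝐑, monomial 1 1 * f = g * monomial 1 1 := by
  induction f using induction_monomial_add with
  | zero => exact ⟨0, by simp⟩
  | monomial n c =>
    exact ⟨monomial n (c ^ (p ^ a)), by
      simp only [monomial_mul_monomial, one_pow, mul_one, one_mul, pow_one, add_comm]⟩
  | add f g hf hg =>
    obtain ⟨f', hf⟩ := hf
    obtain ⟨g', hg⟩ := hg
    exact ⟨f' + g', by rw [mul_add, hf, hg, add_mul]⟩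

theorem exists_eq_C_add_mul_X (f : 𝐑) : ∃ g : 𝐑, f = monomial 0 (f.coeff 0) + g * monomial 1 1 := by
  induction f using induction_monomial_add with
  | zero => exact ⟨0, ext_coeff fun n => by simp [coeff_monomial]⟩
  | monomial n c =>
    rcases n with _ | n
    · exact ⟨0, by simp [coeff_monomial]⟩
    · refine ⟨monomial n c, ext_coeff fun k => ?_⟩
      simp [coeff_monomial, monomial_mul_monomial]
  | add f g hf hg =>
    obtain ⟨f', hf⟩ := hf
    obtain ⟨g', hg⟩ := hg
    refine ⟨f' + g', ?_⟩
    have h : (monomial 0 ((f + g).coeff 0) : 𝐑) = monomial 0 (f.coeff 0) + monomial 0 (g.coeff 0) :=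
      ext_coeff fun n => by simp only [coeff_monomial, coeff_add]; split_ifs <;> simp
    rw [h, add_mul]
    nth_rewrite 1 [hf]
    nth_rewrite 1 [hg]
    abel

theorem central_of_commute {z : 𝐑} (hX : z * monomial 1 1 = monomial 1 1 * z)
    (hC : ∀ c, z * monomial 0 c = monomial 0 c * z) (x : 𝐑) : z * x = x * z := by
  change Commute z x
  induction x using induction_monomial_add with
  | zero => exact Commute.zero_right z
  | monomial n c =>
    rw [monomial_eq_mul_pow]
    exact Commute.mul_right (hC c) (Commute.pow_right hX n)
  | add f g hf hg => exact hf.add_right hg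

theorem monomial_central {n : ℕ} (hn : ∀ c : K, c ^ ((p ^ a) ^ n) = c) (x : 𝐑) :
    monomial n 1 * x = x * monomial n 1 :=
  central_of_commute (by simp only [monomial_mul_monomial, one_pow, add_comm])
    (fun c => by simp [monomial_mul_monomial, hn]) x

theorem card_support_mul_X_pow (f : 𝐑) (n : ℕ) :
    (f * monomial n 1).support.card = f.support.card := by
  have : (f * monomial n 1).support = f.support.map (addRightEmbedding n) := by
    ext k
    simp only [mem_support, coeff_mul_monomial, one_pow, mul_one, Finset.mem_map,
      addRightEmbedding_apply]
    constructor
    · intro h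
      split_ifs at h with hk
      · exact ⟨k - n, h, by omega⟩
      · exact absurd rfl h
    · rintro ⟨i, hi, rfl⟩
      simpa using hi
  rw [this, Finset.card_map]

theorem support_C_mul {c : K} (hc : c ≠ 0) (f : 𝐑) : (monomial 0 c * f).support = f.support := by
  ext k
  simp [coeff_monomial_mul, hc]

/-! ### Central elements separating simple modules -/

section Modules

variable {M N : Type*} [AddCommGroup M] [Module (FrobeniusSkewPolynomial K p a) M]
  [AddCommGroup N] [Module (FrobeniusSkewPolynomial K p a) N]

/-- Since `X f` always has the form `g X`, the kernel of `X` is a submodule. -/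
theorem X_smul_eq_zero_or_injective (M : Type*) [AddCommGroup M] [Module 𝐑 M]
    [IsSimpleModule 𝐑 M] :
    (∀ m : M, (monomial 1 1 : 𝐑) • m = 0) ∨
      Function.Injective fun m : M => (monomial 1 1 : 𝐑) • m := by
  let L : Submodule 𝐑 M :=
    { carrier := {m | (monomial 1 1 : 𝐑) • m = 0}
      zero_mem' := smul_zero _
      add_mem' := fun {x y} (hx : _ = 0) (hy : _ = 0) => by
        simp only [Set.mem_ofPred_eq, smul_add, hx, hy, add_zero]
      smul_mem' := fun f m (hm : _ = 0) => by
        obtain ⟨g, hg⟩ := exists_X_mul_eq f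
        simp only [Set.mem_ofPred_eq, ← mul_smul, hg]
        rw [mul_smul, hm, smul_zero] }
  have hL : ∀ m, m ∈ L ↔ (monomial 1 1 : 𝐑) • m = 0 := fun m => Iff.rfl
  rcases eq_bot_or_eq_top L with h | h
  · refine Or.inr fun x y hxy => sub_eq_zero.1 ((mem_bot 𝐑).1 (h ▸ (hL _).2 ?_))
    rw [smul_sub, sub_eq_zero]
    exact hxy
  · exact Or.inl fun m => (hL m).1 (h ▸ mem_top)

theorem X_pow_smul_bijective [Finite M]
    (h : Function.Injective fun m : M => (monomial 1 1 : 𝐑) • m) (n : ℕ) :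
    Function.Bijective fun m : M => (monomial n 1 : 𝐑) • m := by
  have : (fun m : M => (monomial n 1 : 𝐑) • m) = (fun m : M => (monomial 1 1 : 𝐑) • m)^[n] := by
    rw [smul_iterate, monomial_one_pow]
  rw [this]
  exact Function.Bijective.iterate (Finite.injective_iff_bijective.1 h) n

/-- Every `f` acts through its constant coefficient, which must vanish if `f` kills a nonzero
module. -/
theorem annihilator_le_of_X_smul_eq_zero [Nontrivial M]
    (hN : ∀ m : N, (monomial 1 1 : 𝐑) • m = 0) (hM : ∀ m : M, (monomial 1 1 : 𝐑) • m = 0) :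
    Module.annihilator 𝐑 M ≤ Module.annihilator 𝐑 N := by
  intro f hf
  rw [Module.mem_annihilator] at hf ⊢
  obtain ⟨g, hg⟩ := exists_eq_C_add_mul_X f
  obtain ⟨m, hm⟩ := exists_ne (0 : M)
  have h0 : f.coeff 0 = 0 := by
    by_contra hne
    have := hf m
    rw [hg, add_smul, mul_smul, hM, smul_zero, add_zero] at this
    apply hm
    rw [← one_smul 𝐑 m, ← monomial_zero_inv_mul hne, mul_smul, this, smul_zero]
  intro n
  have h0' : (monomial 0 (0 : K) : 𝐑) = 0 := ext_coeff fun n => by simp [coeff_monomial]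
  rw [hg, h0, h0', zero_add, mul_smul, hN, smul_zero]

/-- `f` annihilates `M` but not `N`, and no shorter skew polynomial does. -/
structure IsShortest (M N : Type*) [AddCommGroup M] [Module 𝐑 M] [AddCommGroup N] [Module 𝐑 N]
    (f : 𝐑) : Prop where
  mem : ∀ m : M, f • m = 0
  notMem : ∃ n : N, f • n ≠ 0
  shortest : ∀ g : 𝐑, (∀ m : M, g • m = 0) → g.support.card < f.support.card → ∀ n : N, g • n = 0

theorem exists_isShortest (h : ¬ Module.annihilator 𝐑 M ≤ Module.annihilator 𝐑 N) :
    ∃ f : 𝐑, IsShortest M N f := by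
  obtain ⟨f₀, h₀, h₀'⟩ := SetLike.not_le_iff_exists.1 h
  let S : Set 𝐑 := {f | (∀ m : M, f • m = 0) ∧ ∃ n : N, f • n ≠ 0}
  have hS : S.Nonempty :=
    ⟨f₀, Module.mem_annihilator.1 h₀, by simpa [Module.mem_annihilator] using h₀'⟩
  obtain ⟨f, hf, hmin⟩ := (measure fun f : 𝐑 => f.support.card).wf.has_min S hS
  refine ⟨f, hf.1, hf.2, fun g hg hlt => ?_⟩
  by_contra! hne
  exact hmin g ⟨hg, hne⟩ hlt

namespace IsShortest

variable {f : FrobeniusSkewPolynomial K p a}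

theorem of_card_le (hf : IsShortest M N f) {g : 𝐑} (h₁ : ∀ m : M, g • m = 0)
    (h₂ : ∃ n : N, g • n ≠ 0) (hle : g.support.card ≤ f.support.card) : IsShortest M N g :=
  ⟨h₁, h₂, fun g' hg' hlt => hf.shortest g' hg' (hlt.trans_le hle)⟩

theorem C_mul (hf : IsShortest M N f) {c : K} (hc : c ≠ 0) :
    IsShortest M N (monomial 0 c * f) := by
  obtain ⟨n, hn⟩ := hf.notMem
  refine hf.of_card_le (fun m => by rw [mul_smul, hf.mem, smul_zero]) ⟨n, fun h => hn ?_⟩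
    (support_C_mul hc f ▸ le_rfl)
  rw [← one_smul 𝐑 (f • n), ← monomial_zero_inv_mul hc, mul_smul, ← mul_smul _ f, h, smul_zero]

theorem mul_X_pow (hf : IsShortest M N f) {k : ℕ}
    (hk : Function.Surjective fun n : N => (monomial k 1 : 𝐑) • n) :
    IsShortest M N (f * monomial k 1) := by
  obtain ⟨n, hn⟩ := hf.notMem
  obtain ⟨n', rfl⟩ := hk n
  exact hf.of_card_le (fun m => by rw [mul_smul, hf.mem]) ⟨n', by rwa [mul_smul]⟩
    (card_support_mul_X_pow f k).le

theorem ne_zero (hf : IsShortest M N f) : ∃ j, f.coeff j ≠ 0 := by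
  obtain ⟨n, hn⟩ := hf.notMem
  by_contra! h
  exact hn (by rw [ext_coeff (g := 0) h, zero_smul])

theorem smul_eq_zero_of_coeff_eq_zero (hf : IsShortest M N f) {g : 𝐑} (hg : ∀ m : M, g • m = 0)
    (hsub : ∀ i, g.coeff i ≠ 0 → f.coeff i ≠ 0) {j : ℕ} (hj : f.coeff j ≠ 0)
    (hgj : g.coeff j = 0) (n : N) : g • n = 0 := by
  refine hf.shortest g hg (Finset.card_lt_card ⟨fun i hi => ?_, fun h => ?_⟩) n
  · exact mem_support.2 (hsub i (mem_support.1 hi))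
  · exact mem_support.1 (h (mem_support.2 hj)) hgj

/-- Rigidity of shortest elements. Cancelling the term at `j` leaves `d`, too short not to kill `N`.
If `d ≠ 0`, using `d` to cancel a term of `f` leaves `e`, which kills `N` too; then so does `f`, a
contradiction. -/
theorem exists_coeff_eq_mul (hf : IsShortest M N f) {h : 𝐑} (hh : ∀ m : M, h • m = 0)
    (hsub : ∀ i, h.coeff i ≠ 0 → f.coeff i ≠ 0) : ∃ l : K, ∀ i, h.coeff i = l * f.coeff i := by
  obtain ⟨j, hj⟩ := hf.ne_zero
  refine ⟨h.coeff j / f.coeff j, fun i => ?_⟩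
  let d : 𝐑 := h - monomial 0 (h.coeff j / f.coeff j) * f
  have hd : ∀ i, d.coeff i = h.coeff i - h.coeff j / f.coeff j * f.coeff i := fun i => by
    simp [d, coeff_monomial_mul]
  by_contra hne
  have hdi : d.coeff i ≠ 0 := by rw [hd]; exact sub_ne_zero.2 hne
  have hdsub : ∀ i, d.coeff i ≠ 0 → f.coeff i ≠ 0 := fun i hi h0 => hi (by
    have : h.coeff i = 0 := by_contra fun hi => hsub i hi h0
    rw [hd, h0, this, mul_zero, sub_zero])
  have hdM : ∀ m : M, d • m = 0 := fun m => by
    simp only [d, sub_smul, mul_smul, hh, hf.mem, smul_zero, sub_zero]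
  have hdN : ∀ n : N, d • n = 0 :=
    hf.smul_eq_zero_of_coeff_eq_zero hdM hdsub hj (by rw [hd, div_mul_cancel₀ _ hj, sub_self])
  let e : 𝐑 := f - monomial 0 (f.coeff i / d.coeff i) * d
  have he : ∀ k, e.coeff k = f.coeff k - f.coeff i / d.coeff i * d.coeff k := fun k => by
    simp [e, coeff_monomial_mul]
  have heN : ∀ n : N, e • n = 0 := by
    refine hf.smul_eq_zero_of_coeff_eq_zero (fun m => ?_) (fun k hk h0 => hk ?_)
      (hdsub i hdi) (by rw [he, div_mul_cancel₀ _ hdi, sub_self])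
    · simp only [e, sub_smul, mul_smul, hdM, hf.mem, smul_zero, sub_zero]
    · have : d.coeff k = 0 := by_contra fun hk => hdsub k hk h0
      rw [he, h0, this, mul_zero, sub_zero]
  obtain ⟨n, hn⟩ := hf.notMem
  have := heN n
  simp only [e, sub_smul, mul_smul, hdN, smul_zero, sub_zero] at this
  exact hn this

theorem exists_central (hf : IsShortest M N f) {r : ℕ} (hr : ∀ c : K, c ^ ((p ^ a) ^ r) = c)
    (hr1 : 1 ≤ r)
    (hN : ∀ k, Function.Surjective fun n : N => (monomial k 1 : 𝐑) • n) :
    ∃ z : 𝐑, (∀ x, z * x = x * z) ∧ (∀ m : M, z • m = 0) ∧ ∃ n : N, z • n ≠ 0 := by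
  obtain ⟨j, hj⟩ := hf.ne_zero
  have hf₁ := hf.C_mul (inv_ne_zero hj)
  set f₁ : 𝐑 := monomial 0 (f.coeff j)⁻¹ * f with hf₁def
  have hj₁ : f₁.coeff j = 1 := by simp [hf₁def, coeff_monomial_mul, hj]
  -- Rigidity applied to `f₁ c`: all exponents in the support induce the same power of `σ`.
  have hc : ∀ (c : K) i, f₁.coeff i ≠ 0 → c ^ ((p ^ a) ^ i) = c ^ ((p ^ a) ^ j) := by
    intro c
    have hcoeff : ∀ i, (f₁ * monomial 0 c).coeff i = f₁.coeff i * c ^ ((p ^ a) ^ i) := fun i => by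
      simp [coeff_mul_monomial]
    obtain ⟨l, hl⟩ := hf₁.exists_coeff_eq_mul (h := f₁ * monomial 0 c)
      (fun m => by rw [mul_smul, hf₁.mem])
      (fun i hi h0 => hi (by rw [hcoeff, h0, zero_mul]))
    have hlj := hl j
    rw [hcoeff, hj₁, one_mul, mul_one] at hlj
    intro i hi
    have hli := hl i
    rw [hcoeff, mul_comm] at hli
    rw [hlj, mul_right_cancel₀ hi hli]
  -- The shift moves exponent `j` to `r * j`, where `σ` acts trivially, so `f₂` commutes with
  -- constants.
  have hf₂ := hf₁.mul_X_pow (hN (j * (r - 1)))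
  set f₂ : 𝐑 := f₁ * monomial (j * (r - 1)) 1 with hf₂def
  have hcoeff₂ : ∀ k, f₂.coeff k =
      if j * (r - 1) ≤ k then f₁.coeff (k - j * (r - 1)) else 0 := fun k => by
    simp [hf₂def, coeff_mul_monomial]
  have hjr : j + j * (r - 1) = r * j := by
    obtain ⟨r, rfl⟩ := Nat.exists_eq_add_of_le' hr1
    rw [Nat.add_sub_cancel]; ring
  have hj₂ : f₂.coeff (r * j) = 1 := by
    rw [hcoeff₂, ← hjr, if_pos (by omega), Nat.add_sub_cancel, hj₁]
  have hc₂ : ∀ (c : K) k, f₂.coeff k ≠ 0 → c ^ ((p ^ a) ^ k) = c := by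
    intro c k hk
    rw [hcoeff₂] at hk
    split_ifs at hk with hle
    · obtain ⟨i, rfl⟩ := Nat.exists_eq_add_of_le' hle
      rw [Nat.add_sub_cancel] at hk
      rw [pow_add, pow_mul, hc c i hk, ← pow_mul, ← pow_add, hjr, SkewFactorization.pow_pow_mul_eq_self hr]
    · exact absurd rfl hk
  have hf₃ := hf₂.mul_X_pow (hN r)
  have hcoeff₃ : ∀ k, (f₂ * monomial r 1).coeff k = if r ≤ k then f₂.coeff (k - r) else 0 :=
    fun k => by simp [coeff_mul_monomial]
  have hcoeff₄ : ∀ k, (monomial 1 1 * f₂ * monomial (r - 1) 1).coeff k =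
      if r ≤ k then f₂.coeff (k - r) ^ (p ^ a) else 0 := fun k => by
    simp only [coeff_mul_monomial, coeff_monomial_mul, one_pow, mul_one, one_mul, pow_one]
    by_cases h : r ≤ k
    · rw [if_pos (by omega), if_pos (by omega), if_pos h, show k - (r - 1) - 1 = k - r by omega]
    · rw [if_neg h]
      split_ifs
      · omega
      · rfl
      · rfl
  -- Rigidity for `X f₂ X ^ (r - 1)` against `f₂ X ^ r`; the coefficient `1` at `r * j` forces `l =
  -- 1`, so `σ` fixes all coefficients and `f₂` commutes with `X`.
  obtain ⟨l, hl⟩ := hf₃.exists_coeff_eq_mul (h := monomial 1 1 * f₂ * monomial (r - 1) 1)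
    (fun m => by rw [mul_smul, mul_smul, hf₂.mem, smul_zero])
    (fun i hi h0 => hi (by
      rw [hcoeff₃] at h0
      rw [hcoeff₄]
      split_ifs at h0 ⊢
      · rw [h0]
        simpa using zero_pow_pow (K := K) (p := p) (a := a) 1
      · rfl))
  have hl' : ∀ k, f₂.coeff k ^ (p ^ a) = l * f₂.coeff k := fun k => by
    simpa [hcoeff₃, hcoeff₄] using hl (k + r)
  have hl1 : l = 1 := by simpa [hj₂] using (hl' (r * j)).symm
  subst hl1
  refine ⟨f₂, central_of_commute (ext_coeff fun k => ?_) (fun c => ext_coeff fun k => ?_),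
    hf₂.mem, hf₂.notMem⟩
  · rw [coeff_mul_monomial, coeff_monomial_mul]
    simp only [one_pow, mul_one, one_mul, pow_one, hl']
  · rw [coeff_mul_monomial, coeff_monomial_mul]
    simp only [Nat.zero_le, if_true, Nat.sub_zero, pow_zero, pow_one]
    by_cases h : f₂.coeff k = 0
    · simp [h]
    · rw [hc₂ c k h, mul_comm]

end IsShortest

theorem exists_central_of_not_annihilator_le [Finite M] [Finite N]
    [IsSimpleModule 𝐑 M] [IsSimpleModule 𝐑 N] {r : ℕ} (hr : ∀ c : K, c ^ ((p ^ a) ^ r) = c)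
    (hr1 : 1 ≤ r) (h : ¬ Module.annihilator 𝐑 M ≤ Module.annihilator 𝐑 N) :
    ∃ z : 𝐑, (∀ x, z * x = x * z) ∧ (∀ m : M, z • m = 0) ∧ ∃ n : N, z • n ≠ 0 := by
  have := IsSimpleModule.nontrivial 𝐑 M
  have := IsSimpleModule.nontrivial 𝐑 N
  obtain ⟨n, hn⟩ := exists_ne (0 : N)
  rcases X_smul_eq_zero_or_injective (K := K) (p := p) (a := a) M with hM | hM <;>
    rcases X_smul_eq_zero_or_injective (K := K) (p := p) (a := a) N with hN | hN
  · exact absurd (annihilator_le_of_X_smul_eq_zero hN hM) h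
  · refine ⟨monomial r 1, monomial_central hr, fun m => ?_, n, fun h0 => hn ?_⟩
    · rw [← monomial_one_pow, ← Nat.sub_add_cancel hr1, pow_succ, mul_smul, hM, smul_zero]
    · exact (X_pow_smul_bijective hN r).1 (h0.trans (smul_zero _).symm)
  · let e : Equiv.Perm M := Equiv.ofBijective _ (X_pow_smul_bijective hM r)
    have he : ∀ (k : ℕ) (m : M), (e ^ k) m = (monomial r 1 : 𝐑) ^ k • m := fun k => by
      induction k with
      | zero => simp
      | succ k ih =>
        intro m
        rw [pow_succ', pow_succ', mul_smul, Equiv.Perm.mul_apply, ih]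
        rfl
    have hk : Nat.card (Equiv.Perm M) ≠ 0 := Nat.card_pos.ne'
    refine ⟨monomial r 1 ^ Nat.card (Equiv.Perm M) - 1, fun x => ?_, fun m => ?_, n, ?_⟩
    · exact (((show Commute (monomial r 1) x from monomial_central hr x).pow_left _).sub_left
        (Commute.one_left x))
    · rw [sub_smul, one_smul, ← he, pow_card_eq_one', Equiv.Perm.one_apply, sub_self]
    · obtain ⟨k, hk⟩ := Nat.exists_eq_succ_of_ne_zero hk
      rw [hk, sub_smul, one_smul, pow_succ, mul_smul, ← monomial_one_pow,
        ← Nat.sub_add_cancel hr1, pow_succ (monomial 1 1 : 𝐑) (r - 1), mul_smul _ _ n, hN,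
        smul_zero, smul_zero, zero_sub]
      exact neg_ne_zero.2 hn
  · obtain ⟨f, hf⟩ := exists_isShortest h
    exact hf.exists_central hr hr1 fun k => (X_pow_smul_bijective hN k).2

end Modules

theorem exists_swap [Finite K] {r : ℕ} (hr : ∀ c : K, c ^ ((p ^ a) ^ r) = c) (hr1 : 1 ≤ r)
    {P₁ P₂ : 𝐑} (h₁ : Irreducible P₁) (h₂ : Irreducible P₂) :
    ∃ Q₁ Q₂ : 𝐑, Irreducible Q₁ ∧ Irreducible Q₂ ∧ Q₁ * Q₂ = P₁ * P₂ ∧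
      Nonempty ((𝐑 ⧸ span 𝐑 {P₂}) ≃ₗ[𝐑] (𝐑 ⧸ span 𝐑 {Q₁})) ∧
      Nonempty ((𝐑 ⧸ span 𝐑 {P₁}) ≃ₗ[𝐑] (𝐑 ⧸ span 𝐑 {Q₂})) := by
  have hpid := exists_eq_span_singleton (K := K) (p := p) (a := a)
  have s₁ := isSimpleModule_iff_isCoatom.2
    (SkewFactorization.isCoatom_span_of_irreducible hpid h₁)
  have s₂ := isSimpleModule_iff_isCoatom.2
    (SkewFactorization.isCoatom_span_of_irreducible hpid h₂)
  have f₁ := finite_quotient_span_singleton h₁.ne_zero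
  have f₂ := finite_quotient_span_singleton h₂.ne_zero
  by_cases h : Module.annihilator 𝐑 (𝐑 ⧸ span 𝐑 {P₁}) ≤ Module.annihilator 𝐑 (𝐑 ⧸ span 𝐑 {P₂})
  · obtain ⟨e⟩ := SkewFactorization.nonempty_equiv_of_annihilator_le h
    exact ⟨P₁, P₂, h₁, h₂, rfl, ⟨e.symm⟩, ⟨e⟩⟩
  · obtain ⟨z, hz, hz₁, y, hy⟩ := exists_central_of_not_annihilator_le hr hr1 h
    refine SkewFactorization.exists_swap_of_central hpid h₁ h₂ hz ?_ fun hz₂ => hy ?_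
    · have := hz₁ ((span 𝐑 {P₁}).mkQ 1)
      rwa [← map_smul, smul_eq_mul, mul_one, ← LinearMap.mem_ker, ker_mkQ] at this
    · obtain ⟨x, rfl⟩ := (span 𝐑 {P₂}).mkQ_surjective y
      rw [← map_smul, ← LinearMap.mem_ker, ker_mkQ, smul_eq_mul, hz]
      exact (span 𝐑 {P₂}).smul_mem x hz₂

end FrobeniusSkewPolynomial

end

theorem mainTheorem2 (p a r : ℕ) [Fact p.Prime] (ha : 1 ≤ a) (hr : 1 ≤ r)
    (K : Type*) [Field K] [CharP K p] (hK : Nat.card K = (p ^ a) ^ r)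
    (P : FrobeniusSkewPolynomial K p a)
    (s : ℕ) (f : Fin s → FrobeniusSkewPolynomial K p a)
    (hf : SkewFactorization.IsFactorization P f) (τ : Equiv.Perm (Fin s)) :
    ∃ g : Fin s → FrobeniusSkewPolynomial K p a,
      SkewFactorization.IsFactorization P g ∧
        ∀ i, SkewFactorization.Similar (f (τ i)) (g i) := by
  have hfin : Finite K := Nat.finite_of_card_ne_zero
    (hK ▸ pow_ne_zero _ (pow_ne_zero _ (Fact.out : p.Prime).ne_zero))
  have hσ : ∀ c : K, c ^ ((p ^ a) ^ r) = c := fun c => by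
    have := Fintype.ofFinite K
    rw [← hK, Nat.card_eq_fintype_card, FiniteField.pow_card]
  exact SkewFactorization.exists_isFactorization_of_perm
    (fun _ _ h₁ h₂ => FrobeniusSkewPolynomial.exists_swap hσ hr h₁ h₂) hf τ
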